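/- Let $\zeta$ be the Riemann zeta function (meromorphically continued to $\mathbb{C}$), let $\Gamma$ be the Gamma function, let $n$ run through the positive integers, and for $x>0$ and $w\in\mathbb{C}$ let $x^{w}=e^{w\log x}$ with the real logarithm. The reciprocal $1/\Gamma$ is read as an entire function; thus $1/\Gamma(1-s/2)=0$ at $s=2$. (1) For every fixed $s\in\mathbb{C}$ with $s\neq 1$ and $\operatorname{Re}(s)<3$, \[ \sum_{k=1}^{n-1}\frac{1}{\sin^{s}(\pi k/n)}=\frac{1}{\sqrt{\pi}}\,\frac{\Gamma(1/2-s/2)}{\Gamma(1-s/2)}\,n+2\pi^{-s}\zeta(s)\,n^{s}+o(n^{s})\qquad\text{as } n\to\infty . \] (2) For every fixed $s\in\mathbb{C}$ with $0<\operatorname{Re}(s)<1$, \[ \sum_{k=1}^{n-1}\frac{1}{\sin^{s}(\pi k/n)}=\frac{1}{\sqrt{\pi}}\,\frac{\Gamma(1/2-s/2)}{\Gamma(1-s/2)}\,n+2\pi^{-s}\zeta(s)\,n^{s}+\frac{s}{3}\,\pi^{2-s}\zeta(s-2)\,n^{s-2}+o(n^{s-2})\qquad\text{as } n\to\infty . \]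 Here $o(n^{w})$ denotes a quantity whose quotient by $n^{w}$ tends to $0$ as $n\to\infty$, for fixed $s$. -/

import Mathlib

open scoped Real Asymptotics

/-! For Re s < 0 the function sin(πx)^(-s) is continuous on the circle, and its m-th Fourier
coefficient is `gammaFactor s * gammaQuot |m| s`: the zeroth is a beta integral, and integration by
parts gives the recurrence in m. Sampling at k/n keeps the frequencies divisible by n, so the
cosecant sum is n times the sum of the coefficients at multiples of n.

Next, `gammaQuot N s` equals (N^(s-1) + `quotCoeff s` · N^(s-3)) / Γ(s/2) up to O(N^(Re s - 5)),
uniformly for bounded s (`exists_norm_quotRem_le`). Summed over multiples of n, the two explicit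
terms give ζ(1-s) and ζ(3-s), which the functional equation turns into the stated ζ(s) and ζ(s-2)
terms.

The remainder series still converges, holomorphically in s, for Re s < 3. Both sides are therefore
analytic there off s = 1, and the identity theorem extends the exact formula (`sum_sin_cpow_eq`).
Its remainder is O(n^(s-4)), which yields both expansions. -/

/-! ### Limits for the reciprocal Gamma function -/

open Filter Topology Finset in
theorem Complex.tendsto_inv_GammaSeq (w : ℂ) :
    Tendsto (fun N : ℕ => (Complex.GammaSeq w N)⁻¹) atTop (𝓝 (Complex.Gamma w)⁻¹) := by
  by_cases h : Complex.Gamma w = 0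
  -- At a pole `Complex.Gamma` has the default value 0, so its inverse is the true value of entire
  -- 1/Γ; `GammaSeq` also divides by zero once N ≥ m.
  · obtain ⟨m, rfl⟩ := Complex.Gamma_eq_zero_iff w |>.1 h
    rw [h]
    refine tendsto_const_nhds.congr' ?_
    filter_upwards [eventually_ge_atTop m] with N hN
    have : ∏ j ∈ range (N + 1), (-(m : ℂ) + j) = 0 :=
      prod_eq_zero (mem_range.2 (Nat.lt_succ_of_le hN)) (by simp)
    simp [Complex.GammaSeq, this]
  · exact (Complex.GammaSeq_tendsto_Gamma w).inv₀ h

open Finset in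
theorem Complex.inv_Gamma_eq_prod_mul (z : ℂ) (n : ℕ) :
    (Complex.Gamma z)⁻¹ = (∏ j ∈ range n, (z + j)) * (Complex.Gamma (z + n))⁻¹ := by
  induction n with
  | zero => simp
  | succ n ih =>
    rw [ih, prod_range_succ, Complex.one_div_Gamma_eq_self_mul_one_div_Gamma_add_one (z + n)]
    push_cast
    ring_nf

-- This is Γ(z+N+1) ~ N^z N!. For Re z > 0 it is Euler's limit; the functional equation of Γ lowers
-- z by one at each induction step, reaching every z.
open Filter Topology Finset Nat in
theorem Complex.tendsto_inv_Gamma_add_nat_mul (z : ℂ) :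
    Tendsto (fun N : ℕ => (Complex.Gamma (z + (N + 1 : ℕ)))⁻¹ * ((N : ℂ) ^ z * (N ! : ℂ)))
      atTop (𝓝 1) := by
  have key : ∀ k : ℕ, ∀ z : ℂ, 0 < (z + k).re →
      Tendsto (fun N : ℕ => (Complex.Gamma (z + (N + 1 : ℕ)))⁻¹ * ((N : ℂ) ^ z * (N ! : ℂ)))
        atTop (𝓝 1) := by
    intro k
    induction k with
    | zero =>
      intro z hz
      have hz : 0 < z.re := by simpa using hz
      have h0 := Complex.Gamma_ne_zero_of_re_pos hz
      have := (Complex.GammaSeq_tendsto_Gamma z).const_mul (Complex.Gamma z)⁻¹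
      rw [inv_mul_cancel₀ h0] at this
      refine this.congr fun N => ?_
      rw [Complex.inv_Gamma_eq_prod_mul z (N + 1), Complex.GammaSeq]
      have : ∏ j ∈ range (N + 1), (z + j) ≠ 0 := by
        refine prod_ne_zero_iff.2 fun j _ h => ?_
        have := congrArg Complex.re h
        simp at this
        have : (0 : ℝ) ≤ j := by positivity
        linarith
      field_simp
    | succ k ih =>
      intro z hz
      have h1 := ih (z + 1) (by convert! hz using 2; push_cast; ring)
      have h2 : Tendsto (fun N : ℕ => 1 + (z + 1) * (N : ℂ)⁻¹) atTop (𝓝 (1 + (z + 1) * 0)) :=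
        ((tendsto_inv_atTop_nhds_zero_nat (𝕜 := ℂ)).const_mul _).const_add _
      have h3 := h1.mul h2
      rw [mul_zero, add_zero, mul_one] at h3
      refine h3.congr' ?_
      filter_upwards [eventually_ge_atTop 1] with N hN
      have hN' : (N : ℂ) ≠ 0 := by exact_mod_cast (by omega : N ≠ 0)
      rw [Complex.one_div_Gamma_eq_self_mul_one_div_Gamma_add_one (z + (N + 1 : ℕ)),
        Complex.cpow_add _ _ hN', Complex.cpow_one, add_right_comm z 1]
      field_simp
      push_cast
      ring
  obtain ⟨k, hk⟩ := exists_nat_gt (-z.re)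
  exact key k z (by simp; linarith)

/-! ### The Gamma quotient and its leading behaviour -/

/-- The entire function `(s/2)(s/2+1)⋯(s/2+N-1) / Γ(N + 1 - s/2)`. -/
noncomputable def gammaQuot (N : ℕ) (s : ℂ) : ℂ :=
  (∏ j ∈ Finset.range N, (s / 2 + j)) * (Complex.Gamma (N + 1 - s / 2))⁻¹

theorem gammaQuot_zero (s : ℂ) : gammaQuot 0 s = (Complex.Gamma (1 - s / 2))⁻¹ := by
  simp [gammaQuot]

theorem gammaQuot_succ (N : ℕ) (s : ℂ) :
    (N + 1 - s / 2) * gammaQuot (N + 1) s = (N + s / 2) * gammaQuot N s := by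
  rw [gammaQuot, gammaQuot, Finset.prod_range_succ,
    Complex.one_div_Gamma_eq_self_mul_one_div_Gamma_add_one ((N : ℂ) + 1 - s / 2)]
  push_cast
  rw [show (N : ℂ) + 1 - s / 2 + 1 = N + 1 + 1 - s / 2 by ring]
  ring

theorem differentiable_gammaQuot (N : ℕ) : Differentiable ℂ (gammaQuot N) := by
  unfold gammaQuot
  refine Differentiable.mul ?_ ?_
  · exact Differentiable.fun_finsetProd fun j _ => by fun_prop
  · exact Complex.differentiable_one_div_Gamma.comp (by fun_prop)

open Filter Topology in
theorem tendsto_gammaQuot (s : ℂ) :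
    Tendsto (fun N : ℕ => gammaQuot N s * (N : ℂ) ^ (1 - s)) atTop
      (𝓝 (Complex.Gamma (s / 2))⁻¹) := by
  have h1 := (Complex.tendsto_inv_GammaSeq (s / 2)).mul
    (Complex.tendsto_inv_Gamma_add_nat_mul (1 - s / 2))
  have h2 : ∀ c : ℂ, Tendsto (fun N : ℕ => 1 + c * (N : ℂ)⁻¹) atTop (𝓝 1) := fun c => by
    simpa using ((tendsto_inv_atTop_nhds_zero_nat (𝕜 := ℂ)).const_mul c).const_add 1
  -- `GammaSeq` has N+1 factors, so `h1` concerns `gammaQuot (N + 1) s`; the extra ratio, tending to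
  -- 1, is the recurrence factor that returns to N.
  have h3 := h1.mul ((h2 (1 - s / 2)).div (h2 (s / 2)) one_ne_zero)
  rw [mul_one, div_one, mul_one] at h3
  refine h3.congr' ?_
  filter_upwards [eventually_ge_atTop 1,
    (h2 (s / 2)).eventually_ne one_ne_zero] with N hN h4
  have hN' : (N : ℂ) ≠ 0 := by exact_mod_cast (by omega : N ≠ 0)
  have hf : (N.factorial : ℂ) ≠ 0 := by exact_mod_cast N.factorial_ne_zero
  have hc : (N : ℂ) ^ (s / 2) ≠ 0 := by simp [Complex.cpow_eq_zero_iff, hN']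
  have h5 : (N : ℂ) + s / 2 ≠ 0 := by
    intro h; apply h4
    rw [show 1 + s / 2 * (N : ℂ)⁻¹ = (N + s / 2) / N by field_simp, h, zero_div]
  have hr := gammaQuot_succ N s
  have hg : gammaQuot N s = (N + 1 - s / 2) * gammaQuot (N + 1) s / (N + s / 2) := by
    rw [hr, mul_div_cancel_left₀ _ h5]
  rw [hg, gammaQuot, Complex.GammaSeq]
  have e1 : (N : ℂ) ^ (1 - s) = (N : ℂ) ^ (1 - s / 2) / (N : ℂ) ^ (s / 2) := by
    rw [← Complex.cpow_sub _ _ hN']; ring_nf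
  have e2 : (1 - s / 2 + ((N + 1 : ℕ) : ℂ)) = ((N + 1 : ℕ) : ℂ) + 1 - s / 2 := by ring
  have e3 : (1 + (1 - s / 2) * (N : ℂ)⁻¹) / (1 + s / 2 * (N : ℂ)⁻¹)
      = (N + 1 - s / 2) / (N + s / 2) := by
    rw [div_eq_div_iff h4 h5]
    field_simp
    ring
  simp only [Pi.div_apply]
  rw [e1, e2, e3]
  field_simp

/-! ### Two-term expansion with a uniform remainder -/

/-- The second coefficient in the expansion of `gammaQuot N s / N ^ (s - 1)` in powers of `1/N`. -/
noncomputable def quotCoeff (s : ℂ) : ℂ := -((s - 1) * s * (s - 2)) / 24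

/-- The logarithmic increment of `gammaQuot N s * N ^ (1 - s) * exp (- quotCoeff s / N ^ 2)`,
as a function of `z = 1/N`. -/
noncomputable def quotIncr (s z : ℂ) : ℂ :=
  Complex.log (1 + s / 2 * z) - Complex.log (1 + (1 - s / 2) * z) - (s - 1) * Complex.log (1 + z)
    - quotCoeff s * z ^ 2 * (((1 + z) ^ 2)⁻¹ - 1)

theorem Complex.norm_log_one_add_sub_logTaylor_five_le {u : ℂ} (hu : ‖u‖ ≤ 1 / 2) :
    ‖Complex.log (1 + u) - (u - u ^ 2 / 2 + u ^ 3 / 3 - u ^ 4 / 4)‖ ≤ ‖u‖ ^ 5 := by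
  have h := Complex.norm_log_sub_logTaylor_le 4 (z := u) (by linarith)
  have e : Complex.logTaylor (4 + 1) u = u - u ^ 2 / 2 + u ^ 3 / 3 - u ^ 4 / 4 := by
    simp [Complex.logTaylor, Finset.sum_range_succ]
    ring
  rw [e] at h
  refine h.trans ?_
  have h1 : (1 - ‖u‖)⁻¹ ≤ 2 := by
    rw [inv_le_comm₀ (by linarith) (by norm_num)]
    linarith
  have h2 : ‖u‖ ^ 5 * (1 - ‖u‖)⁻¹ ≤ ‖u‖ ^ 5 * 2 := by gcongr
  have h3 : 0 ≤ ‖u‖ ^ 5 := by positivity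
  push_cast
  norm_num
  linarith

theorem norm_quotCoeff_le {ρ : ℝ} {s : ℂ} (hs : ‖s‖ ≤ ρ) : ‖quotCoeff s‖ ≤ (ρ + 2) ^ 3 := by
  have hρ : 0 ≤ ρ := (norm_nonneg s).trans hs
  have h1 : ‖s - 1‖ ≤ ρ + 2 := (norm_sub_le _ _).trans (by rw [norm_one]; linarith)
  have h2 : ‖s - 2‖ ≤ ρ + 2 := (norm_sub_le _ _).trans (by rw [Complex.norm_ofNat]; linarith)
  have h3 : ‖s‖ ≤ ρ + 2 := by linarith
  rw [quotCoeff, norm_div, norm_neg, norm_mul, norm_mul, Complex.norm_ofNat]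
  have : ‖s - 1‖ * ‖s‖ * ‖s - 2‖ ≤ (ρ + 2) * (ρ + 2) * (ρ + 2) := by gcongr
  have h0 : 0 ≤ (ρ + 2) * (ρ + 2) * (ρ + 2) := by positivity
  calc ‖s - 1‖ * ‖s‖ * ‖s - 2‖ / 24 ≤ (ρ + 2) * (ρ + 2) * (ρ + 2) / 24 := by gcongr
    _ ≤ _ := by rw [pow_three]; linarith

/-- The Taylor coefficients through z^4 cancel: those of z and z^2 because s/2 and 1 - s/2 have sum
1 and difference s - 1, that of z^3 by the choice of `quotCoeff`, and that of z^4 then also. -/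
theorem norm_quotIncr_le {ρ : ℝ} {s z : ℂ} (hs : ‖s‖ ≤ ρ) (hz : ‖z‖ * (2 * (ρ + 2)) ≤ 1) :
    ‖quotIncr s z‖ ≤ 25 * (ρ + 2) ^ 5 * ‖z‖ ^ 5 := by
  have hρ : 0 ≤ ρ := (norm_nonneg s).trans hs
  have hz0 := norm_nonneg z
  have hw : ‖s / 2‖ ≤ ρ + 2 := by
    rw [norm_div, Complex.norm_ofNat]; linarith
  have hw1 : ‖1 - s / 2‖ ≤ ρ + 2 := by
    refine (norm_sub_le _ _).trans ?_
    rw [norm_div, Complex.norm_ofNat, norm_one]; linarith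
  have hs1 : ‖s - 1‖ ≤ ρ + 2 := (norm_sub_le _ _).trans (by rw [norm_one]; linarith)
  have hzh : ‖z‖ ≤ 1 / 2 := by nlinarith
  have hm : ∀ v : ℂ, ‖v‖ ≤ ρ + 2 → ‖v * z‖ ≤ 1 / 2 ∧ ‖v * z‖ ^ 5 ≤ (ρ + 2) ^ 5 * ‖z‖ ^ 5 := by
    intro v hv
    have : ‖v * z‖ ≤ (ρ + 2) * ‖z‖ := by rw [norm_mul]; gcongr
    refine ⟨by nlinarith, ?_⟩
    rw [← mul_pow]; gcongr
  have b1 := (Complex.norm_log_one_add_sub_logTaylor_five_le (hm _ hw).1).trans (hm _ hw).2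
  have b2 := (Complex.norm_log_one_add_sub_logTaylor_five_le (hm _ hw1).1).trans (hm _ hw1).2
  have b3 := Complex.norm_log_one_add_sub_logTaylor_five_le hzh
  have hz1 : 1 / 2 ≤ ‖1 + z‖ := by
    have := norm_sub_norm_le (1 : ℂ) (-z)
    rw [norm_one, norm_neg, sub_neg_eq_add] at this
    linarith
  have hne : 1 + z ≠ 0 := by
    intro h; rw [h, norm_zero] at hz1; linarith
  -- Up to sign, the tail of (1+z)^(-2) after 1 - 2z + 3z^2.
  set R : ℂ := z ^ 3 * (4 + 3 * z) * ((1 + z) ^ 2)⁻¹ with hR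
  have b4 : ‖R‖ ≤ 22 * ‖z‖ ^ 3 := by
    rw [hR, norm_mul, norm_mul, norm_inv, norm_pow, norm_pow]
    have i1 : ‖4 + 3 * z‖ ≤ 11 / 2 := by
      refine (norm_add_le _ _).trans ?_
      rw [norm_mul, Complex.norm_ofNat, Complex.norm_ofNat]; linarith
    have i2 : (‖1 + z‖ ^ 2)⁻¹ ≤ 4 := by
      rw [inv_le_comm₀ (by positivity) (by norm_num)]
      nlinarith
    calc ‖z‖ ^ 3 * ‖4 + 3 * z‖ * (‖1 + z‖ ^ 2)⁻¹ ≤ ‖z‖ ^ 3 * (11 / 2) * 4 := by gcongr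
      _ = _ := by ring
  have hdec : quotIncr s z =
      (Complex.log (1 + s / 2 * z) - (s / 2 * z - (s / 2 * z) ^ 2 / 2 + (s / 2 * z) ^ 3 / 3
        - (s / 2 * z) ^ 4 / 4))
      - (Complex.log (1 + (1 - s / 2) * z) - ((1 - s / 2) * z - ((1 - s / 2) * z) ^ 2 / 2
        + ((1 - s / 2) * z) ^ 3 / 3 - ((1 - s / 2) * z) ^ 4 / 4))
      - (s - 1) * (Complex.log (1 + z) - (z - z ^ 2 / 2 + z ^ 3 / 3 - z ^ 4 / 4))
      + quotCoeff s * z ^ 2 * R := by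
    have : ((1 + z) ^ 2)⁻¹ - 1 = -2 * z + 3 * z ^ 2 - R := by
      rw [hR]; field_simp; ring
    rw [quotIncr, this, quotCoeff]
    ring
  rw [hdec]
  have c3 : ‖(s - 1) * (Complex.log (1 + z) - (z - z ^ 2 / 2 + z ^ 3 / 3 - z ^ 4 / 4))‖
      ≤ (ρ + 2) ^ 5 * ‖z‖ ^ 5 := by
    rw [norm_mul]
    refine mul_le_mul (hs1.trans ?_) b3 (norm_nonneg _) (by positivity)
    exact le_self_pow₀ (by linarith) (by norm_num)
  have c4 : ‖quotCoeff s * z ^ 2 * R‖ ≤ 22 * ((ρ + 2) ^ 5 * ‖z‖ ^ 5) := by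
    rw [norm_mul, norm_mul, norm_pow]
    have h35 : (ρ + 2) ^ 3 ≤ (ρ + 2) ^ 5 := pow_le_pow_right₀ (by linarith) (by norm_num)
    calc ‖quotCoeff s‖ * ‖z‖ ^ 2 * ‖R‖ ≤ (ρ + 2) ^ 5 * ‖z‖ ^ 2 * (22 * ‖z‖ ^ 3) := by
          gcongr
          exact (norm_quotCoeff_le hs).trans h35
      _ = _ := by ring
  refine (norm_add_le _ _).trans ?_
  have d1 := norm_sub_le
    (Complex.log (1 + s / 2 * z) - (s / 2 * z - (s / 2 * z) ^ 2 / 2 + (s / 2 * z) ^ 3 / 3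
        - (s / 2 * z) ^ 4 / 4))
    (Complex.log (1 + (1 - s / 2) * z) - ((1 - s / 2) * z - ((1 - s / 2) * z) ^ 2 / 2
        + ((1 - s / 2) * z) ^ 3 / 3 - ((1 - s / 2) * z) ^ 4 / 4))
  have d2 := norm_sub_le
    ((Complex.log (1 + s / 2 * z) - (s / 2 * z - (s / 2 * z) ^ 2 / 2 + (s / 2 * z) ^ 3 / 3
        - (s / 2 * z) ^ 4 / 4))
      - (Complex.log (1 + (1 - s / 2) * z) - ((1 - s / 2) * z - ((1 - s / 2) * z) ^ 2 / 2
        + ((1 - s / 2) * z) ^ 3 / 3 - ((1 - s / 2) * z) ^ 4 / 4)))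
    ((s - 1) * (Complex.log (1 + z) - (z - z ^ 2 / 2 + z ^ 3 / 3 - z ^ 4 / 4)))
  linarith

/-- The normalisation of `gammaQuot N s` that converges to `1 / Γ(s/2)` at rate `N ^ (-4)`. -/
noncomputable def quotNormalized (N : ℕ) (s : ℂ) : ℂ :=
  gammaQuot N s * (N : ℂ) ^ (1 - s) * Complex.exp (-(quotCoeff s / (N : ℂ) ^ 2))

theorem quotNormalized_succ {ρ : ℝ} {s : ℂ} (hs : ‖s‖ ≤ ρ) {N : ℕ} (hN : 2 * (ρ + 2) ≤ N) :
    quotNormalized (N + 1) s = quotNormalized N s * Complex.exp (quotIncr s (N : ℂ)⁻¹) := by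
  have hρ : 0 ≤ ρ := (norm_nonneg s).trans hs
  have hN0 : (0 : ℝ) < N := by linarith
  have hN' : (N : ℂ) ≠ 0 := by exact_mod_cast hN0.ne'
  have hsmall : ∀ v : ℂ, ‖v‖ ≤ ρ + 2 → 1 + v * (N : ℂ)⁻¹ ≠ 0 := by
    intro v hv h
    have h1 : v * (N : ℂ)⁻¹ = -1 := by linear_combination h
    have h2 : ‖v * (N : ℂ)⁻¹‖ = 1 := by rw [h1]; simp
    rw [norm_mul, norm_inv, Complex.norm_natCast, mul_inv_eq_iff_eq_mul₀ hN0.ne'] at h2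
    linarith
  have hw : ‖s / 2‖ ≤ ρ + 2 := by
    rw [norm_div, Complex.norm_ofNat]; linarith
  have hw1 : ‖1 - s / 2‖ ≤ ρ + 2 := by
    refine (norm_sub_le _ _).trans ?_
    rw [norm_div, Complex.norm_ofNat, norm_one]; linarith
  have n1 := hsmall _ hw
  have n2 := hsmall _ hw1
  have n3 : 1 + (N : ℂ)⁻¹ ≠ 0 := by
    simpa using hsmall 1 (by rw [norm_one]; linarith)
  have e1 : ((N + 1 : ℕ) : ℂ) ^ (1 - s) = (N : ℂ) ^ (1 - s) * (1 + (N : ℂ)⁻¹) ^ (1 - s) := by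
    have h := Complex.mul_cpow_ofReal_nonneg (a := N) (b := 1 + (N : ℝ)⁻¹) (by positivity)
      (by positivity) (1 - s)
    push_cast at h ⊢
    rw [← h]
    congr 1
    field_simp
  have e2 : (1 + (N : ℂ)⁻¹) ^ (1 - s) = Complex.exp (-((s - 1) * Complex.log (1 + (N : ℂ)⁻¹))) := by
    rw [Complex.cpow_def_of_ne_zero n3]
    ring_nf
  have e3 : gammaQuot (N + 1) s
      = gammaQuot N s * (1 + s / 2 * (N : ℂ)⁻¹) / (1 + (1 - s / 2) * (N : ℂ)⁻¹) := by
    rw [eq_div_iff n2]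
    have hr := gammaQuot_succ N s
    have : (N : ℂ) * (N : ℂ)⁻¹ = 1 := mul_inv_cancel₀ hN'
    linear_combination (N : ℂ)⁻¹ * hr + (gammaQuot N s - gammaQuot (N + 1) s) * this
  have e4 : quotIncr s (N : ℂ)⁻¹ = Complex.log (1 + s / 2 * (N : ℂ)⁻¹)
      - Complex.log (1 + (1 - s / 2) * (N : ℂ)⁻¹) + -((s - 1) * Complex.log (1 + (N : ℂ)⁻¹))
      + (-(quotCoeff s / ((N + 1 : ℕ) : ℂ) ^ 2) - -(quotCoeff s / (N : ℂ) ^ 2)) := by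
    have : (N : ℂ)⁻¹ ^ 2 * ((1 + (N : ℂ)⁻¹) ^ 2)⁻¹ = (((N + 1 : ℕ) : ℂ) ^ 2)⁻¹ := by
      rw [← inv_pow, ← mul_pow, ← inv_pow, ← mul_inv]
      congr 2
      push_cast
      field_simp
    rw [quotIncr, mul_assoc _ (_ ^ 2), mul_sub, this]
    field_simp
    ring
  rw [quotNormalized, quotNormalized, e4, Complex.exp_add, Complex.exp_add, Complex.exp_sub,
    Complex.exp_log n1, Complex.exp_log n2, Complex.exp_sub, e1, e2, e3]
  field_simp

open Finset in
theorem quotNormalized_eq_mul_exp_sum {ρ : ℝ} {s : ℂ} (hs : ‖s‖ ≤ ρ) {N : ℕ}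
    (hN : 2 * (ρ + 2) ≤ N) {M : ℕ} (hM : N ≤ M) :
    quotNormalized M s
      = quotNormalized N s * Complex.exp (∑ j ∈ Ico N M, quotIncr s (j : ℂ)⁻¹) := by
  induction M, hM using Nat.le_induction with
  | base => simp
  | succ M hM ih =>
    have : 2 * (ρ + 2) ≤ M := hN.trans (by exact_mod_cast hM)
    rw [quotNormalized_succ hs this, ih, sum_Ico_succ_top hM, Complex.exp_add, mul_assoc]

open Finset in
theorem norm_sum_quotIncr_le {ρ : ℝ} {s : ℂ} (hs : ‖s‖ ≤ ρ) {N : ℕ}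
    (hN : 2 * (ρ + 2) ≤ N) (M : ℕ) :
    ‖∑ j ∈ Ico N M, quotIncr s (j : ℂ)⁻¹‖ ≤ 50 * (ρ + 2) ^ 5 / N ^ 4 := by
  have hρ : 0 ≤ ρ := (norm_nonneg s).trans hs
  have hN0 : (0 : ℝ) < N := by linarith
  have hN1 : 1 ≤ N := by exact_mod_cast hN0
  refine (norm_sum_le _ _).trans ?_
  -- Three of the five powers of 1/j are traded for 1/N^3, leaving a sum of inverse squares bounded
  -- by 2/N independently of M.
  have h1 : ∀ j ∈ Ico N M, ‖quotIncr s (j : ℂ)⁻¹‖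
      ≤ 25 * (ρ + 2) ^ 5 / N ^ 3 * ((j : ℝ) ^ 2)⁻¹ := by
    intro j hj
    have hNj : (N : ℝ) ≤ j := by exact_mod_cast (mem_Ico.1 hj).1
    have hj0 : (0 : ℝ) < j := hN0.trans_le hNj
    refine (norm_quotIncr_le hs ?_).trans ?_
    · rw [norm_inv, Complex.norm_natCast, inv_mul_le_iff₀ hj0]
      linarith
    · rw [norm_inv, Complex.norm_natCast, div_mul_eq_mul_div, le_div_iff₀ (by positivity), mul_assoc]
      have : ((j : ℝ)⁻¹) ^ 5 * N ^ 3 ≤ ((j : ℝ)⁻¹) ^ 5 * j ^ 3 := by gcongr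
      calc _ ≤ 25 * (ρ + 2) ^ 5 * (((j : ℝ)⁻¹) ^ 5 * j ^ 3) := by gcongr
        _ = _ := by field_simp
  refine (sum_le_sum h1).trans ?_
  rw [← mul_sum]
  have h2 : ∑ j ∈ Ico N M, ((j : ℝ) ^ 2)⁻¹ ≤ 2 / N := by
    have h := sum_Ioo_inv_sq_le (α := ℝ) (N - 1) M
    have e : Ioo (N - 1) M = Ico N M := by
      ext j; simp only [mem_Ioo, mem_Ico]; omega
    rw [e, Nat.cast_sub hN1] at h
    simpa using h
  calc _ ≤ 25 * (ρ + 2) ^ 5 / N ^ 3 * (2 / N) := by gcongr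
    _ = _ := by field_simp; ring

open Filter Topology in
theorem tendsto_quotNormalized (s : ℂ) :
    Tendsto (fun N : ℕ => quotNormalized N s) atTop (𝓝 (Complex.Gamma (s / 2))⁻¹) := by
  have h : Tendsto (fun N : ℕ => Complex.exp (-(quotCoeff s / (N : ℂ) ^ 2))) atTop
      (𝓝 (Complex.exp (-(quotCoeff s * 0 ^ 2)))) := by
    refine (Complex.continuous_exp.tendsto _).comp (Tendsto.neg ?_)
    simp_rw [div_eq_mul_inv, ← inv_pow]
    exact ((tendsto_inv_atTop_nhds_zero_nat (𝕜 := ℂ)).pow 2).const_mul _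
  unfold quotNormalized
  simpa using (tendsto_gammaQuot s).mul h

open Filter Topology in
theorem norm_quotNormalized_sub_le {ρ : ℝ} {s : ℂ} (hs : ‖s‖ ≤ ρ) {N : ℕ}
    (hN : 2 * (ρ + 2) ≤ N) (hN2 : 50 * (ρ + 2) ^ 5 ≤ N) :
    ‖quotNormalized N s - (Complex.Gamma (s / 2))⁻¹‖
      ≤ ‖(Complex.Gamma (s / 2))⁻¹‖ * (100 * (ρ + 2) ^ 5 / N ^ 4) := by
  have hρ : 0 ≤ ρ := (norm_nonneg s).trans hs
  have hN1 : (1 : ℝ) ≤ N := by linarith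
  have hlim := tendsto_quotNormalized s
  -- Stage N is compared with a later stage M and M tends to infinity; the error is relative to
  -- stage M, so no bound on `quotNormalized` is needed.
  refine le_of_tendsto_of_tendsto (hlim.const_sub _).norm (hlim.norm.mul_const _) ?_
  filter_upwards [eventually_ge_atTop N] with M hM
  have hE := quotNormalized_eq_mul_exp_sum hs hN hM
  have hS := norm_sum_quotIncr_le hs hN M
  set S := ∑ j ∈ Finset.Ico N M, quotIncr s (j : ℂ)⁻¹
  have hS1 : ‖-S‖ ≤ 1 := by
    rw [norm_neg]
    refine hS.trans ((div_le_one (by positivity)).2 ?_)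
    exact hN2.trans (le_self_pow₀ hN1 (by norm_num))
  have hE' : quotNormalized N s = quotNormalized M s * Complex.exp (-S) := by
    rw [hE, mul_assoc, ← Complex.exp_add, add_neg_cancel, Complex.exp_zero, mul_one]
  have h1 : quotNormalized N s - quotNormalized M s
      = quotNormalized M s * (Complex.exp (-S) - 1) := by
    rw [hE']; ring
  rw [h1, norm_mul]
  gcongr
  refine (Complex.norm_exp_sub_one_le hS1).trans ?_
  rw [norm_neg]
  calc 2 * ‖S‖ ≤ 2 * (50 * (ρ + 2) ^ 5 / N ^ 4) := by gcongr
    _ = _ := by ring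

/-- The remainder of `gammaQuot N s` after the first two terms of its expansion in `N`. -/
noncomputable def quotRem (N : ℕ) (s : ℂ) : ℂ :=
  gammaQuot N s - (Complex.Gamma (s / 2))⁻¹ *
    ((N : ℂ) ^ (s - 1) + quotCoeff s * (N : ℂ) ^ (s - 3))

/-- Uniformity over the disc is what later makes the remainder series holomorphic in s. -/
theorem exists_norm_quotRem_le (ρ : ℝ) :
    ∃ C : ℝ, 0 ≤ C ∧ ∃ N₀ : ℕ, 1 ≤ N₀ ∧ ∀ s : ℂ, ‖s‖ ≤ ρ → ∀ N : ℕ, N₀ ≤ N →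
      ‖quotRem N s‖ ≤ C * (N : ℝ) ^ (s.re - 5) := by
  obtain ⟨B, hB⟩ : ∃ B : ℝ, ∀ s ∈ Metric.closedBall (0 : ℂ) ρ, ‖(Complex.Gamma (s / 2))⁻¹‖ ≤ B := by
    refine (isCompact_closedBall (0 : ℂ) ρ).exists_bound_of_continuousOn ?_
    exact (Complex.differentiable_one_div_Gamma.continuous.comp
      (continuous_id.div_const 2)).continuousOn
  obtain ⟨N₀, hN₀⟩ := exists_nat_gt (2 * (ρ + 2) + 50 * (ρ + 2) ^ 5 + (ρ + 2) ^ 3)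
  -- For ρ < 0 the disc is empty; the indicator only keeps the constant nonnegative.
  refine ⟨|B| * (3 * (100 * (ρ + 2) ^ 5)  + (ρ + 2) ^ 6) * (if 0 ≤ ρ then 1 else 0), ?_, N₀ + 1, by omega,
    fun s hs N hN => ?_⟩
  · split_ifs with h
    · positivity
    · simp
  have hρ : 0 ≤ ρ := (norm_nonneg s).trans hs
  rw [if_pos hρ, mul_one]
  have hNr : (N₀ : ℝ) ≤ N := by exact_mod_cast (Nat.le_of_succ_le hN)
  have p5 : 0 ≤ (ρ + 2) ^ 5 := by positivity
  have p3 : 0 ≤ (ρ + 2) ^ 3 := by positivity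
  have hN0 : (0 : ℝ) < N := by linarith
  have hN1 : (1 : ℝ) ≤ N := by linarith
  have hN' : (N : ℂ) ≠ 0 := by exact_mod_cast hN0.ne'
  have hv := norm_quotNormalized_sub_le hs (N := N) (by linarith) (by linarith)
  set g := (Complex.Gamma (s / 2))⁻¹
  have hg : ‖g‖ ≤ |B| := (hB s (by simpa using hs)).trans (le_abs_self B)
  set x : ℂ := quotCoeff s / (N : ℂ) ^ 2 with hx
  have hx0 : ‖x‖ ≤ (ρ + 2) ^ 3 / N ^ 2 := by
    rw [hx, norm_div, norm_pow, Complex.norm_natCast]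
    gcongr
    exact norm_quotCoeff_le hs
  have hx1 : ‖x‖ ≤ 1 := by
    refine hx0.trans ((div_le_one (by positivity)).2 ?_)
    have : (N : ℝ) ≤ N ^ 2 := le_self_pow₀ hN1 (by norm_num)
    linarith
  have hexp : ‖Complex.exp x‖ ≤ 3 := by
    have h1 := Complex.norm_exp_sub_one_le hx1
    have h2 := norm_add_le (Complex.exp x - 1) 1
    rw [sub_add_cancel, norm_one] at h2
    linarith
  have hexp2 : ‖Complex.exp x - 1 - x‖ ≤ (ρ + 2) ^ 6 / N ^ 4 := by
    refine (Complex.norm_exp_sub_one_sub_id_le hx1).trans ?_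
    calc ‖x‖ ^ 2 ≤ ((ρ + 2) ^ 3 / N ^ 2) ^ 2 := by gcongr
      _ = _ := by ring
  have e1 : gammaQuot N s = (N : ℂ) ^ (s - 1) * (quotNormalized N s * Complex.exp x) := by
    have h1 : Complex.exp (-x) * Complex.exp x = 1 := by
      rw [← Complex.exp_add, neg_add_cancel, Complex.exp_zero]
    have h2 : (N : ℂ) ^ (s - 1) * (N : ℂ) ^ (1 - s) = 1 := by
      rw [← Complex.cpow_add _ _ hN']; simp
    rw [quotNormalized, ← hx]
    calc gammaQuot N s = gammaQuot N s * ((N : ℂ) ^ (s - 1) * (N : ℂ) ^ (1 - s)) *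
          (Complex.exp (-x) * Complex.exp x) := by rw [h1, h2, mul_one, mul_one]
      _ = _ := by ring
  have e2 : (N : ℂ) ^ (s - 3) = (N : ℂ) ^ (s - 1) / (N : ℂ) ^ 2 := by
    rw [← Complex.cpow_natCast, ← Complex.cpow_sub _ _ hN']
    congr 1; push_cast; ring
  -- Two errors of order N^(-4): the convergence error of `quotNormalized`, and exp x - 1 - x with x
  -- of order N^(-2).
  have e3 : quotRem N s = (N : ℂ) ^ (s - 1) *
      ((quotNormalized N s - g) * Complex.exp x + g * (Complex.exp x - 1 - x)) := by
    rw [quotRem, e1, e2, hx]; ring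
  have e4 : ‖(N : ℂ) ^ (s - 1)‖ = (N : ℝ) ^ (s.re - 5) * N ^ 4 := by
    have := Complex.norm_cpow_eq_rpow_re_of_pos hN0 (s - 1)
    rw [Complex.ofReal_natCast] at this
    rw [this, ← Real.rpow_natCast, ← Real.rpow_add hN0]
    congr 1; simp; ring
  rw [e3, norm_mul, e4, mul_assoc, mul_comm ((N : ℝ) ^ (s.re - 5))]
  refine mul_le_mul_of_nonneg_right ?_ (Real.rpow_nonneg hN0.le _)
  calc (N : ℝ) ^ 4 * ‖(quotNormalized N s - g) * Complex.exp x + g * (Complex.exp x - 1 - x)‖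
      ≤ (N : ℝ) ^ 4 * (|B| * (100 * (ρ + 2) ^ 5 / N ^ 4) * 3 + |B| * ((ρ + 2) ^ 6 / N ^ 4)) := by
        gcongr
        refine (norm_add_le _ _).trans ?_
        rw [norm_mul, norm_mul]
        gcongr
        exact hv.trans (by gcongr)
    _ = _ := by field_simp

/-! ### Fourier coefficients of powers of the sine -/

/-- The Fourier coefficients of `x ↦ sin (π x) ^ (-s)` on `[0, 1]`. -/
noncomputable def sinCoeff (s : ℂ) (m : ℤ) : ℂ :=
  ∫ x in (0 : ℝ)..1, Complex.exp (-(2 * π * Complex.I * m * x)) * ((Real.sin (π * x) : ℝ) : ℂ) ^ (-s)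

theorem continuous_sin_cpow {w : ℂ} (hw : 0 < w.re) :
    Continuous fun x : ℝ => ((Real.sin (π * x) : ℝ) : ℂ) ^ w :=
  (Complex.continuous_ofReal_cpow_const hw).comp (by fun_prop)

/-- The half-integer frequency m + 1/2 is chosen so that writing sin and cos as combinations of
e^(±iπx) produces exactly the integrands of two consecutive coefficients. -/
theorem hasDerivAt_sin_cpow_mul_exp (s : ℂ) (m : ℤ) {x : ℝ} (hx : 0 < Real.sin (π * x)) :
    HasDerivAt (fun x : ℝ => ((Real.sin (π * x) : ℝ) : ℂ) ^ (1 - s) *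
        Complex.exp (-(π * Complex.I * (2 * m + 1) * x)))
      (π * ((m + 1 - s / 2) * (Complex.exp (-(2 * π * Complex.I * (m + 1 : ℤ) * x)) *
          ((Real.sin (π * x) : ℝ) : ℂ) ^ (-s)) -
        (m + s / 2) * (Complex.exp (-(2 * π * Complex.I * m * x)) *
          ((Real.sin (π * x) : ℝ) : ℂ) ^ (-s)))) x := by
  have hsin : HasDerivAt (fun z : ℂ => Complex.sin (π * z)) (Complex.cos (π * x) * π) (x : ℂ) := by
    simpa using ((hasDerivAt_id' (x : ℂ)).const_mul (π : ℂ)).csin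
  have hcast : Complex.sin (π * x) = ((Real.sin (π * x) : ℝ) : ℂ) := by push_cast; rfl
  have h1 := hsin.cpow_const (c := 1 - s) (by rw [hcast]; exact Complex.ofReal_mem_slitPlane.2 hx)
  have h2 : HasDerivAt (fun z : ℂ => Complex.exp (-(π * Complex.I * (2 * m + 1) * z)))
      (Complex.exp (-(π * Complex.I * (2 * m + 1) * x)) * -(π * Complex.I * (2 * m + 1))) (x : ℂ) := by
    simpa using ((hasDerivAt_id' (x : ℂ)).const_mul (π * Complex.I * (2 * m + 1))).fun_neg.cexp
  have h3 := (h1.mul h2).comp_ofReal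
  have hne : Complex.sin (π * x) ≠ 0 := by
    rw [hcast]; exact_mod_cast hx.ne'
  convert! h3 using 1
  · ext y; simp
  · rw [← hcast, show 1 - s - 1 = -s by ring, sub_eq_neg_add 1 s, Complex.cpow_add _ _ hne,
      Complex.cpow_one]
    have hsn : Complex.sin (π * x) * Complex.I * 2
        = Complex.exp (π * x * Complex.I) - Complex.exp (-(π * x * Complex.I)) := by
      rw [Complex.sin, neg_mul]
      linear_combination (Complex.exp (-(π * x * Complex.I)) - Complex.exp (π * x * Complex.I)) *
        Complex.I_mul_I
    have hcs : Complex.cos (π * x) * 2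
        = Complex.exp (π * x * Complex.I) + Complex.exp (-(π * x * Complex.I)) := by
      rw [Complex.cos, neg_mul]; ring
    have e1 : Complex.exp (-(2 * π * Complex.I * m * x))
        = Complex.exp (-(π * Complex.I * (2 * m + 1) * x)) * Complex.exp (π * x * Complex.I) := by
      rw [← Complex.exp_add]; ring_nf
    have e2 : Complex.exp (-(2 * π * Complex.I * (m + 1 : ℤ) * x))
        = Complex.exp (-(π * Complex.I * (2 * m + 1) * x)) *
          Complex.exp (-(π * x * Complex.I)) := by
      rw [← Complex.exp_add]; push_cast; ring_nf
    rw [e1, e2]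
    linear_combination (-Complex.sin (π * x) ^ (-s) *
      Complex.exp (-(π * Complex.I * (2 * m + 1) * x)) * π * (1 - s) / 2) * hcs +
      (Complex.sin (π * x) ^ (-s) *
      Complex.exp (-(π * Complex.I * (2 * m + 1) * x)) * π * (2 * m + 1) / 2) * hsn

theorem continuous_sinCoeff_integrand {s : ℂ} (hs : s.re < 0) (m : ℤ) :
    Continuous fun x : ℝ =>
      Complex.exp (-(2 * π * Complex.I * m * x)) * ((Real.sin (π * x) : ℝ) : ℂ) ^ (-s) :=
  (by fun_prop : Continuous fun x : ℝ => Complex.exp (-(2 * π * Complex.I * m * x))).mul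
    (continuous_sin_cpow (by simpa using hs))

theorem sin_pi_mul_pos {x : ℝ} (hx : x ∈ Set.Ioo (0 : ℝ) 1) : 0 < Real.sin (π * x) := by
  refine Real.sin_pos_of_pos_of_lt_pi (mul_pos Real.pi_pos hx.1) ?_
  nlinarith [Real.pi_pos, hx.2]

/-- The preceding derivative integrates to zero over [0, 1], since sin^(1-s) vanishes at both ends.
The recurrence is that of `gammaQuot`. -/
theorem sinCoeff_succ {s : ℂ} (hs : s.re < 0) (m : ℤ) :
    (m + 1 - s / 2) * sinCoeff s (m + 1) = (m + s / 2) * sinCoeff s m := by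
  have c1 := continuous_sinCoeff_integrand hs m
  have c2 := continuous_sinCoeff_integrand hs (m + 1)
  have hs1 : 0 < (1 - s).re := by simp; linarith
  have hcont : Continuous fun x : ℝ => ((Real.sin (π * x) : ℝ) : ℂ) ^ (1 - s) *
      Complex.exp (-(π * Complex.I * (2 * m + 1) * x)) :=
    (continuous_sin_cpow hs1).mul (by fun_prop)
  have h := intervalIntegral.integral_eq_sub_of_hasDerivAt_of_le (zero_le_one (α := ℝ))
    hcont.continuousOn
    (fun x hx => hasDerivAt_sin_cpow_mul_exp s m (sin_pi_mul_pos hx))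
    (Continuous.intervalIntegrable (by fun_prop) 0 1)
  have h0 : (1 - s) ≠ 0 := fun h => by rw [h] at hs1; simp at hs1
  rw [intervalIntegral.integral_const_mul, intervalIntegral.integral_sub
    (Continuous.intervalIntegrable (by fun_prop) 0 1)
    (Continuous.intervalIntegrable (by fun_prop) 0 1), intervalIntegral.integral_const_mul,
    intervalIntegral.integral_const_mul] at h
  simp only [mul_one, mul_zero, Real.sin_pi, Real.sin_zero, Complex.ofReal_zero,
    Complex.zero_cpow h0, zero_mul, sub_zero] at h
  have hpi : (π : ℂ) ≠ 0 := by exact_mod_cast Real.pi_ne_zero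
  have := (mul_eq_zero.1 h).resolve_left hpi
  exact sub_eq_zero.1 this

theorem sinCoeff_neg (s : ℂ) (m : ℤ) : sinCoeff s (-m) = sinCoeff s m := by
  have h := intervalIntegral.integral_comp_sub_left (a := 0) (b := 1) (fun x : ℝ =>
    Complex.exp (-(2 * π * Complex.I * m * x)) * ((Real.sin (π * x) : ℝ) : ℂ) ^ (-s)) 1
  rw [sub_self, sub_zero] at h
  rw [sinCoeff, sinCoeff, ← h]
  refine intervalIntegral.integral_congr fun x _ => ?_
  have e1 : Real.sin (π * (1 - x)) = Real.sin (π * x) := by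
    rw [mul_sub, mul_one, Real.sin_pi_sub]
  have e2 : Complex.exp (-(2 * π * Complex.I * m * ((1 - x : ℝ) : ℂ)))
      = Complex.exp (-(2 * π * Complex.I * ((-m : ℤ) : ℂ) * x)) := by
    rw [Complex.exp_eq_exp_iff_exists_int]
    exact ⟨-m, by push_cast; ring⟩
  simp only [e1, e2]

/-- The constant `Γ((1-s)/2) / √π`. -/
noncomputable def gammaFactor (s : ℂ) : ℂ := Complex.Gamma (1 / 2 - s / 2) / (√π : ℂ)

-- The substitution t = (1 - cos πx)/2 satisfies t(1-t) = (sin(πx)/2)^2 and turns the integral into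
-- B(u, u) with u = (1-s)/2; the duplication formula simplifies the result.
open MeasureTheory in
theorem sinCoeff_zero {s : ℂ} (hs : s.re < 0) :
    sinCoeff s 0 = gammaFactor s * (Complex.Gamma (1 - s / 2))⁻¹ := by
  set u : ℂ := 1 / 2 - s / 2 with hu
  have hure : 0 < u.re := by simp [hu]; linarith
  set f : ℝ → ℝ := fun x => (1 - Real.cos (π * x)) / 2 with hf
  set f' : ℝ → ℝ := fun x => π * (Real.sin (π * x) / 2) with hf'
  set g : ℝ → ℂ := fun t => (t : ℂ) ^ (u - 1) * (1 - (t : ℂ)) ^ (u - 1) with hg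
  have hfd : ∀ x, HasDerivAt f (f' x) x := by
    intro x
    have h := (((Real.hasDerivAt_cos (π * x)).comp x ((hasDerivAt_id x).const_mul π)).const_sub
      1).div_const 2
    convert! h using 1
    simp only [hf']; ring
  have hcomp : ∀ x ∈ Set.Icc (0 : ℝ) 1,
      f' x • (g ∘ f) x = π * (2 : ℂ) ^ s * ((Real.sin (π * x) : ℝ) : ℂ) ^ (-s) := by
    intro x hx
    have hsn : 0 ≤ Real.sin (π * x) :=
      Real.sin_nonneg_of_nonneg_of_le_pi (by have := hx.1; positivity)
        (by nlinarith [Real.pi_pos, hx.2])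
    have hs0 : -s ≠ 0 := fun h => by
      rw [neg_eq_zero] at h; rw [h] at hs; simp at hs
    rcases hsn.eq_or_lt with h0 | hpos
    · simp [hf', ← h0, Complex.zero_cpow hs0]
    · have hy : (0 : ℝ) ≤ Real.sin (π * x) / 2 := by positivity
      have hyne : ((Real.sin (π * x) / 2 : ℝ) : ℂ) ≠ 0 := by
        exact_mod_cast (by positivity : Real.sin (π * x) / 2 ≠ 0)
      have hc1 := Real.neg_one_le_cos (π * x)
      have hc2 := Real.cos_le_one (π * x)
      have e1 : (g ∘ f) x = ((Real.sin (π * x) / 2 : ℝ) : ℂ) ^ (2 * u - 2) := by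
        simp only [Function.comp, hg]
        rw [show (1 : ℂ) - (f x : ℂ) = ((1 - f x : ℝ) : ℂ) by push_cast; ring,
          ← Complex.mul_cpow_ofReal_nonneg (by simp only [hf]; linarith)
            (by simp only [hf]; linarith), ← Complex.ofReal_mul,
          show f x * (1 - f x) = (Real.sin (π * x) / 2) * (Real.sin (π * x) / 2) by
            simp only [hf]; nlinarith [Real.sin_sq_add_cos_sq (π * x)],
          Complex.ofReal_mul, Complex.mul_cpow_ofReal_nonneg hy hy, ← Complex.cpow_add _ _ hyne]
        ring_nf
      have e2 : ((Real.sin (π * x) / 2 : ℝ) : ℂ) ^ (-s)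
          = (2 : ℂ) ^ s * ((Real.sin (π * x) : ℝ) : ℂ) ^ (-s) := by
        have h := Complex.mul_cpow_ofReal_nonneg (a := Real.sin (π * x) / 2) (b := 2) hy
          (by norm_num) (-s)
        have h2 : (2 : ℂ) ^ s * (2 : ℂ) ^ (-s) = 1 := by
          rw [← Complex.cpow_add _ _ two_ne_zero]; simp
        have h3 : ((Real.sin (π * x) / 2 : ℝ) : ℂ) * ((2 : ℝ) : ℂ) = (Real.sin (π * x) : ℝ) := by
          push_cast; ring
        rw [h3] at h
        rw [h]
        push_cast at h2 ⊢
        linear_combination -(Complex.sin (π * x) / 2) ^ (-s) * h2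
      have e3 : ((Real.sin (π * x) / 2 : ℝ) : ℂ) ^ (-s)
          = ((Real.sin (π * x) / 2 : ℝ) : ℂ) * ((Real.sin (π * x) / 2 : ℝ) : ℂ) ^ (2 * u - 2) := by
        rw [show -s = 1 + (2 * u - 2) by rw [hu]; ring, Complex.cpow_add _ _ hyne, Complex.cpow_one]
      rw [e1, mul_assoc, ← e2, e3, Complex.real_smul, hf', Complex.ofReal_mul, mul_assoc]
  have himg : f '' Set.uIcc 0 1 ⊆ Set.Icc 0 1 := by
    rintro _ ⟨x, -, rfl⟩
    have hc1 := Real.neg_one_le_cos (π * x)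
    have hc2 := Real.cos_le_one (π * x)
    exact ⟨by simp only [hf]; linarith, by simp only [hf]; linarith⟩
  have hint : IntegrableOn g (Set.Icc 0 1) := by
    have := Complex.betaIntegral_convergent hure hure
    rwa [intervalIntegrable_iff_integrableOn_Icc_of_le zero_le_one] at this
  have hsub := intervalIntegral.integral_deriv_smul_comp''' (a := 0) (b := 1) (f := f) (f' := f')
    (g := g) (fun x _ => (hfd x).continuousAt.continuousWithinAt)
    (fun x _ => (hfd x).hasDerivWithinAt) ?_ (hint.mono_set himg) ?_
  · have hb : ∫ t in f 0..f 1, g t = Complex.betaIntegral u u := by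
      simp [hf, hg, Complex.betaIntegral]
    have hl : ∫ x in (0 : ℝ)..1, f' x • (g ∘ f) x = π * (2 : ℂ) ^ s * sinCoeff s 0 := by
      rw [sinCoeff, ← intervalIntegral.integral_const_mul]
      refine intervalIntegral.integral_congr fun x hx => ?_
      rw [Set.uIcc_of_le zero_le_one] at hx
      simp only [hcomp x hx]
      simp
    rw [hl, hb] at hsub
    have hB := Complex.Gamma_mul_Gamma_eq_betaIntegral hure hure
    have hD := Complex.Gamma_mul_Gamma_add_half u
    rw [← hsub, ← two_mul] at hB
    have g1 := Complex.Gamma_ne_zero_of_re_pos hure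
    have g2 : Complex.Gamma (u + 1 / 2) ≠ 0 :=
      Complex.Gamma_ne_zero_of_re_pos (by simp; linarith)
    have g3 : Complex.Gamma (2 * u) ≠ 0 := Complex.Gamma_ne_zero_of_re_pos (by simpa using hure)
    have hsq : ((√π : ℝ) : ℂ) * ((√π : ℝ) : ℂ) = π := by
      rw [← Complex.ofReal_mul, Real.mul_self_sqrt Real.pi_pos.le]
    have hsne : ((√π : ℝ) : ℂ) ≠ 0 := by
      exact_mod_cast (Real.sqrt_pos.2 Real.pi_pos).ne'
    have e1 : 1 - 2 * u = s := by rw [hu]; ring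
    have e2 : u + 1 / 2 = 1 - s / 2 := by rw [hu]; ring
    rw [e1] at hD
    rw [gammaFactor, ← hu, ← e2]
    generalize Complex.Gamma (u + 1 / 2) = V at hD g2 ⊢
    field_simp
    refine mul_left_cancel₀ g1 ?_
    linear_combination ((√π : ℝ) : ℂ) * sinCoeff s 0 * hD - hB
      + Complex.Gamma (2 * u) * 2 ^ s * sinCoeff s 0 * hsq
  · rintro _ ⟨x, hx, rfl⟩
    rw [min_eq_left zero_le_one, max_eq_right zero_le_one] at hx
    have hp := sin_pi_mul_pos hx
    have h1 : 0 < f x ∧ 0 < 1 - f x := by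
      have := Real.sin_sq_add_cos_sq (π * x)
      have hlt : Real.cos (π * x) ^ 2 < 1 := by nlinarith
      have := abs_lt.1 ((sq_lt_one_iff_abs_lt_one _).1 hlt)
      simp only [hf]
      constructor <;> linarith [this.1, this.2]
    refine ContinuousAt.continuousWithinAt ?_
    refine ContinuousAt.mul ?_ ?_
    · exact (by fun_prop : ContinuousAt (fun t : ℝ => (t : ℂ)) (f x)).cpow continuousAt_const
        (Complex.ofReal_mem_slitPlane.2 h1.1)
    · refine (by fun_prop : ContinuousAt (fun t : ℝ => (1 - (t : ℂ))) (f x)).cpow continuousAt_const ?_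
      rw [show (1 : ℂ) - (f x : ℂ) = ((1 - f x : ℝ) : ℂ) by push_cast; ring]
      exact Complex.ofReal_mem_slitPlane.2 h1.2
  · rw [Set.uIcc_of_le zero_le_one]
    refine IntegrableOn.congr_fun (f := fun x : ℝ =>
      π * (2 : ℂ) ^ s * ((Real.sin (π * x) : ℝ) : ℂ) ^ (-s)) ?_
      (fun x hx => (hcomp x hx).symm) measurableSet_Icc
    exact ((continuous_sin_cpow (by simpa using hs)).const_mul _).continuousOn.integrableOn_Icc

theorem sinCoeff_natCast {s : ℂ} (hs : s.re < 0) (m : ℕ) :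
    sinCoeff s m = gammaFactor s * gammaQuot m s := by
  induction m with
  | zero => rw [gammaQuot_zero]; exact sinCoeff_zero hs
  | succ m ih =>
    have h1 := sinCoeff_succ hs m
    have h2 := gammaQuot_succ m s
    have h0 : (m : ℂ) + 1 - s / 2 ≠ 0 := fun h => by
      have := congrArg Complex.re h
      simp at this
      have : (0 : ℝ) ≤ m := by positivity
      linarith
    push_cast at h1 ⊢
    refine mul_left_cancel₀ h0 ?_
    rw [h1, ih]
    linear_combination -gammaFactor s * h2

/-! ### Fourier series and sampling at k/n -/

theorem summable_natCast_cpow {w : ℂ} (hw : w.re < -1) : Summable fun n : ℕ => (n : ℂ) ^ w := by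
  have h := Complex.summable_one_div_nat_cpow (p := -w) |>.2 (by simp; linarith)
  simpa [Complex.cpow_neg] using h

theorem summable_quotRem {s : ℂ} (hs : s.re < 4) : Summable fun N : ℕ => quotRem N s := by
  obtain ⟨C, -, N₀, -, h⟩ := exists_norm_quotRem_le ‖s‖
  refine Summable.of_norm_bounded_eventually_nat (g := fun N : ℕ => C * (N : ℝ) ^ (s.re - 5))
    ((Real.summable_nat_rpow.2 (by linarith)).mul_left C) ?_
  filter_upwards [Filter.eventually_ge_atTop N₀] with N hN using h s le_rfl N hN

theorem summable_gammaQuot {s : ℂ} (hs : s.re < 0) : Summable fun N : ℕ => gammaQuot N s := by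
  have h1 := summable_quotRem (s := s) (by linarith)
  have h2 := summable_natCast_cpow (w := s - 1) (by simp; linarith)
  have h3 := summable_natCast_cpow (w := s - 3) (by simp; linarith)
  refine (h1.add ((h2.add (h3.mul_left (quotCoeff s))).mul_left (Complex.Gamma (s / 2))⁻¹)).congr
    fun N => ?_
  rw [quotRem]; ring

theorem summable_sinCoeff {s : ℂ} (hs : s.re < 0) : Summable (sinCoeff s) := by
  have h : Summable fun N : ℕ => sinCoeff s N := by
    simp_rw [sinCoeff_natCast hs]
    exact (summable_gammaQuot hs).mul_left _
  exact summable_int_iff_summable_nat_and_neg.2 ⟨h, by simpa only [sinCoeff_neg] using h⟩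

theorem hasSum_sinCoeff {s : ℂ} (hs : s.re < 0) {x : ℝ} (hx : x ∈ Set.Ico (0 : ℝ) 1) :
    HasSum (fun m : ℤ => sinCoeff s m * Complex.exp (2 * π * Complex.I * m * x))
      (((Real.sin (π * x) : ℝ) : ℂ) ^ (-s)) := by
  set f : ℝ → ℂ := fun x => ((Real.sin (π * x) : ℝ) : ℂ) ^ (-s) with hf
  have hcont : Continuous f := continuous_sin_cpow (by simpa using hs)
  let F : C(UnitAddCircle, ℂ) := ⟨AddCircle.liftIco 1 0 f,
    AddCircle.liftIco_continuous (by simp [hf]) hcont.continuousOn⟩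
  have hF : ∀ x ∈ Set.Ico (0 : ℝ) 1, F (x : UnitAddCircle) = f x := fun x hx =>
    AddCircle.liftIco_zero_coe_apply (f := f) hx
  have hcoeff : fourierCoeff F = sinCoeff s := by
    ext m
    rw [fourierCoeff_eq_intervalIntegral F m 0, zero_add, div_one, one_smul, sinCoeff]
    -- The lift to the circle is controlled on [0, 1) but the integral runs over (0, 1]; the point 1
    -- is null.
    refine intervalIntegral.integral_congr_ae ?_
    have hne : ∀ᵐ x : ℝ, x ≠ 1 := by
      simp [MeasureTheory.ae_iff]
    filter_upwards [hne] with x hx1 hx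
    rw [Set.uIoc_of_le zero_le_one] at hx
    rw [hF x ⟨hx.1.le, lt_of_le_of_ne hx.2 hx1⟩, fourier_coe_apply, smul_eq_mul]
    congr 2
    push_cast
    ring
  have h := has_pointwise_sum_fourier_series_of_summable (f := F)
    (by rw [hcoeff]; exact summable_sinCoeff hs) (x : UnitAddCircle)
  rw [hF x hx, hcoeff] at h
  refine h.congr_fun fun m => ?_
  rw [fourier_coe_apply, smul_eq_mul]
  congr 2
  push_cast
  ring

open Finset in
theorem sum_exp_two_pi_mul_div {n : ℕ} (hn : n ≠ 0) (m : ℤ) :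
    ∑ k ∈ range n, Complex.exp (2 * π * Complex.I * m * ((k / n : ℝ) : ℂ))
      = if (n : ℤ) ∣ m then (n : ℂ) else 0 := by
  have hn' : (n : ℂ) ≠ 0 := by exact_mod_cast hn
  set ζ := Complex.exp (2 * π * Complex.I * m / n) with hζ
  have hk : ∀ k : ℕ, Complex.exp (2 * π * Complex.I * m * ((k / n : ℝ) : ℂ)) = ζ ^ k := by
    intro k
    rw [hζ, ← Complex.exp_nat_mul]
    congr 1; push_cast; ring
  simp_rw [hk]
  split_ifs with h
  · obtain ⟨j, rfl⟩ := h
    have : ζ = 1 := by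
      rw [hζ, Complex.exp_eq_one_iff]
      exact ⟨j, by push_cast; field_simp⟩
    simp [this]
  · have h1 : ζ ≠ 1 := by
      rw [hζ, Ne, Complex.exp_eq_one_iff]
      rintro ⟨j, hj⟩
      apply h
      refine ⟨j, ?_⟩
      have h2 : (m : ℂ) = n * j := by
        have := Complex.two_pi_I_ne_zero
        field_simp at hj
        exact hj
      exact_mod_cast h2
    have h2 : ζ ^ n = 1 := by
      rw [hζ, ← Complex.exp_nat_mul, Complex.exp_eq_one_iff]
      exact ⟨m, by field_simp⟩
    rw [geom_sum_eq h1, h2, sub_self, zero_div]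

theorem hasSum_sinCoeff_mul {s : ℂ} (hs : s.re < 0) {n : ℕ} (hn : n ≠ 0) :
    HasSum (fun m : ℤ => n * sinCoeff s (n * m))
      (∑ k ∈ Finset.Ico 1 n, 1 / ((Real.sin (π * k / n) : ℝ) : ℂ) ^ s) := by
  have hn0 : (0 : ℝ) < n := by exact_mod_cast Nat.pos_of_ne_zero hn
  have h1 := hasSum_sum (s := Finset.range n) fun k hk => hasSum_sinCoeff hs (x := k / n)
    ⟨by positivity, (div_lt_one hn0).2 (by exact_mod_cast Finset.mem_range.1 hk)⟩
  simp_rw [← Finset.mul_sum, sum_exp_two_pi_mul_div hn] at h1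
  -- Needed for 0^(-s) = 0, so that the sample at k = 0 drops out.
  have hs0 : -s ≠ 0 := fun h => by
    rw [neg_eq_zero] at h; rw [h] at hs; simp at hs
  have h2 : ∑ k ∈ Finset.range n, ((Real.sin (π * (k / n)) : ℝ) : ℂ) ^ (-s)
      = ∑ k ∈ Finset.Ico 1 n, 1 / ((Real.sin (π * k / n) : ℝ) : ℂ) ^ s := by
    rw [Finset.range_eq_Ico, Finset.sum_eq_sum_Ico_succ_bot (Nat.pos_of_ne_zero hn)]
    simp [Complex.zero_cpow hs0, Complex.cpow_neg, mul_div_assoc]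
  rw [h2] at h1
  have hinj : Function.Injective fun m : ℤ => (n : ℤ) * m := fun a b h =>
    mul_left_cancel₀ (by exact_mod_cast hn) h
  rw [← hinj.hasSum_iff] at h1
  · refine h1.congr_fun fun m => ?_
    simp [mul_comm]
  · intro m hm
    rw [if_neg, mul_zero]
    rintro ⟨j, rfl⟩
    exact hm ⟨j, rfl⟩

/-- Poisson summation for the finite cosecant power sum. -/
theorem sum_sin_cpow_eq_tsum {s : ℂ} (hs : s.re < 0) {n : ℕ} (hn : n ≠ 0) :
    ∑ k ∈ Finset.Ico 1 n, 1 / ((Real.sin (π * k / n) : ℝ) : ℂ) ^ s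
      = n * (gammaFactor s * (Complex.Gamma (1 - s / 2))⁻¹)
        + 2 * n * gammaFactor s * ∑' m : ℕ, gammaQuot (n * (m + 1)) s := by
  have h := hasSum_sinCoeff_mul hs hn
  have heven : Function.Even fun m : ℤ => n * sinCoeff s (n * m) := by
    intro m
    simp only [mul_neg, sinCoeff_neg]
  rw [← h.tsum_eq, tsum_int_eq_zero_add_two_mul_tsum_pnat heven h.summable, mul_zero,
    sinCoeff_zero hs, tsum_pnat_eq_tsum_succ (f := fun m : ℕ => n * sinCoeff s (n * (m : ℤ)))]
  have : ∀ m : ℕ, (n : ℂ) * sinCoeff s (n * ((m + 1 : ℕ) : ℤ))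
      = n * gammaFactor s * gammaQuot (n * (m + 1)) s := by
    intro m
    have := sinCoeff_natCast hs (n * (m + 1))
    push_cast at this ⊢
    rw [this, mul_assoc]
  simp_rw [this, tsum_mul_left]
  ring

/-! ### Functional equation and the exact formula for Re s < 0 -/

theorem gammaFactor_mul_riemannZeta_one_sub {s : ℂ} (hs : s.re < 0) :
    gammaFactor s * (Complex.Gamma (s / 2))⁻¹ * riemannZeta (1 - s)
      = (π : ℂ) ^ (-s) * riemannZeta s := by
  have hs0 : s ≠ 0 := fun h => by rw [h] at hs; simp at hs
  have hs1 : 1 - s ≠ 0 := fun h => by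
    have := congrArg Complex.re h; simp at this; linarith
  have hpi : (π : ℂ) ≠ 0 := by exact_mod_cast Real.pi_ne_zero
  have hG : Complex.Gammaℝ (1 - s) ≠ 0 := Complex.Gammaℝ_ne_zero_of_re_pos (by simp; linarith)
  have h1 : riemannZeta s = riemannZeta (1 - s) * Complex.Gammaℝ (1 - s) / Complex.Gammaℝ s := by
    rw [riemannZeta_def_of_ne_zero hs0, riemannZeta_def_of_ne_zero hs1,
      completedRiemannZeta_one_sub, div_mul_cancel₀ _ hG]
  have hsq : ((√π : ℝ) : ℂ) = (π : ℂ) ^ (1 / 2 : ℂ) := by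
    rw [Real.sqrt_eq_rpow, Complex.ofReal_cpow Real.pi_pos.le]; norm_num
  have h2 : (π : ℂ) ^ (-s) * ((π : ℂ) ^ (-(1 - s) / 2) * ((π : ℂ) ^ (-s / 2))⁻¹)
      = ((√π : ℝ) : ℂ)⁻¹ := by
    rw [hsq, ← Complex.cpow_neg, ← Complex.cpow_neg, ← Complex.cpow_add _ _ hpi,
      ← Complex.cpow_add _ _ hpi]
    ring_nf
  rw [h1, Complex.Gammaℝ_def, Complex.Gammaℝ_def, gammaFactor,
    div_eq_mul_inv _ ((√π : ℝ) : ℂ), ← h2, show (1 - s) / 2 = 1 / 2 - s / 2 by ring]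
  field_simp

/-- The previous identity at s - 2: shifting both Gamma factors costs (1-s)(s-2)/4, which is `2 *
quotCoeff s` divided by s/3 when s ≠ 0. -/
theorem gammaFactor_mul_riemannZeta_three_sub {s : ℂ} (hs : s.re < 0) :
    2 * gammaFactor s * (Complex.Gamma (s / 2))⁻¹ * quotCoeff s * riemannZeta (3 - s)
      = s / 3 * (π : ℂ) ^ (2 - s) * riemannZeta (s - 2) := by
  have h := gammaFactor_mul_riemannZeta_one_sub (s := s - 2) (by simp; linarith)
  have hne : 1 / 2 - s / 2 ≠ 0 := fun h => by
    have := congrArg Complex.re h; simp at this; linarith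
  have h1 : gammaFactor (s - 2) = (1 / 2 - s / 2) * gammaFactor s := by
    rw [gammaFactor, show (1 : ℂ) / 2 - (s - 2) / 2 = 1 / 2 - s / 2 + 1 by ring,
      Complex.Gamma_add_one _ hne, gammaFactor, mul_div_assoc]
  have h2 : (Complex.Gamma ((s - 2) / 2))⁻¹ = (s / 2 - 1) * (Complex.Gamma (s / 2))⁻¹ := by
    rw [show (s - 2) / 2 = s / 2 - 1 by ring,
      Complex.one_div_Gamma_eq_self_mul_one_div_Gamma_add_one (s / 2 - 1), sub_add_cancel]
  rw [h1, h2, show 1 - (s - 2) = 3 - s by ring, neg_sub] at h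
  rw [mul_assoc (s / 3), ← h, quotCoeff]
  ring

theorem hasSum_natCast_mul_cpow {w : ℂ} (hw : w.re < -1) (n : ℕ) :
    HasSum (fun m : ℕ => ((n * (m + 1) : ℕ) : ℂ) ^ w) ((n : ℂ) ^ w * riemannZeta (-w)) := by
  have hz := zeta_eq_tsum_one_div_nat_add_one_cpow (s := -w) (by simp; linarith)
  have hsum : Summable fun m : ℕ => ((m + 1 : ℕ) : ℂ) ^ w :=
    (summable_nat_add_iff 1).2 (summable_natCast_cpow hw)
  have h := (hsum.hasSum).mul_left ((n : ℂ) ^ w)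
  have e : ∑' m : ℕ, ((m + 1 : ℕ) : ℂ) ^ w = riemannZeta (-w) := by
    rw [hz]
    refine tsum_congr fun m => ?_
    rw [Complex.cpow_neg, one_div, inv_inv]
    push_cast; rfl
  rw [e] at h
  refine h.congr_fun fun m => ?_
  have := Complex.mul_cpow_ofReal_nonneg (a := n) (b := (m + 1 : ℕ)) (by positivity)
    (by positivity) w
  push_cast at this ⊢
  exact this

/-- The sum of the terms of order `n`, `n ^ s` and `n ^ (s - 2)` in the expansion of
`∑ sin (π k / n) ^ (-s)`. -/
noncomputable def cosecantMainTerm (n : ℕ) (s : ℂ) : ℂ :=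
  n * (gammaFactor s * (Complex.Gamma (1 - s / 2))⁻¹) + 2 * (π : ℂ) ^ (-s) * riemannZeta s * (n : ℂ) ^ s
    + s / 3 * (π : ℂ) ^ (2 - s) * riemannZeta (s - 2) * (n : ℂ) ^ (s - 2)

theorem summable_quotRem_mul {s : ℂ} (hs : s.re < 4) {n : ℕ} (hn : n ≠ 0) :
    Summable fun m : ℕ => quotRem (n * (m + 1)) s :=
  (summable_quotRem hs).comp_injective (i := fun m : ℕ => n * (m + 1)) fun a b h => by
    simpa [hn] using h

theorem gammaQuot_eq_quotRem_add (N : ℕ) (s : ℂ) :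
    gammaQuot N s = quotRem N s + (Complex.Gamma (s / 2))⁻¹ *
      ((N : ℂ) ^ (s - 1) + quotCoeff s * (N : ℂ) ^ (s - 3)) := by
  rw [quotRem, sub_add_cancel]

theorem sum_sin_cpow_eq_of_re_neg {s : ℂ} (hs : s.re < 0) {n : ℕ} (hn : n ≠ 0) :
    ∑ k ∈ Finset.Ico 1 n, 1 / ((Real.sin (π * k / n) : ℝ) : ℂ) ^ s
      = cosecantMainTerm n s + 2 * n * gammaFactor s * ∑' m : ℕ, quotRem (n * (m + 1)) s := by
  have hn' : (n : ℂ) ≠ 0 := by exact_mod_cast hn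
  have h1 := hasSum_natCast_mul_cpow (w := s - 1) (by simp; linarith) n
  have h3 := hasSum_natCast_mul_cpow (w := s - 3) (by simp; linarith) n
  rw [neg_sub] at h1 h3
  have hr := (summable_quotRem_mul (s := s) (by linarith) hn).hasSum
  have ha := hr.add ((h1.add (h3.mul_left (quotCoeff s))).mul_left (Complex.Gamma (s / 2))⁻¹)
  have ha' := ha.tsum_eq
  simp_rw [← gammaQuot_eq_quotRem_add] at ha'
  have f1 := gammaFactor_mul_riemannZeta_one_sub hs
  have f3 := gammaFactor_mul_riemannZeta_three_sub hs
  have p1 : (n : ℂ) * (n : ℂ) ^ (s - 1) = (n : ℂ) ^ s := by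
    rw [Complex.cpow_sub _ _ hn', Complex.cpow_one, mul_div_cancel₀ _ hn']
  have p3 : (n : ℂ) * (n : ℂ) ^ (s - 3) = (n : ℂ) ^ (s - 2) := by
    rw [show s - 3 = s - 2 - 1 by ring, Complex.cpow_sub _ _ hn', Complex.cpow_one,
      mul_div_cancel₀ _ hn']
  rw [sum_sin_cpow_eq_tsum hs hn, ha', cosecantMainTerm, ← f3, mul_assoc 2 _ (riemannZeta s), ← f1,
    ← p1, ← p3]
  ring

/-! ### Analytic continuation to Re s < 3 -/

theorem differentiableAt_gammaFactor {s : ℂ} (hs : s.re < 3) (h1 : s ≠ 1) :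
    DifferentiableAt ℂ gammaFactor s := by
  unfold gammaFactor
  refine DifferentiableAt.div_const (DifferentiableAt.comp s
    (Complex.differentiableAt_Gamma _ fun m hm => ?_) (by fun_prop)) _
  rcases m with _ | m
  · apply h1; linear_combination -2 * hm
  · have := congrArg Complex.re hm
    simp at this
    have : (0 : ℝ) ≤ m := by positivity
    linarith

theorem differentiable_quotRem (N : ℕ) (hN : N ≠ 0) : Differentiable ℂ (quotRem N) := by
  have hN' : (N : ℂ) ≠ 0 := by exact_mod_cast hN
  have h1 : Differentiable ℂ fun s : ℂ => (Complex.Gamma (s / 2))⁻¹ :=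
    Complex.differentiable_one_div_Gamma.comp (by fun_prop)
  have h2 : ∀ c : ℂ, Differentiable ℂ fun s : ℂ => (N : ℂ) ^ (s - c) := fun c s =>
    DifferentiableAt.const_cpow (by fun_prop) (Or.inl hN')
  have h3 : Differentiable ℂ quotCoeff := by unfold quotCoeff; fun_prop
  unfold quotRem
  exact (differentiable_gammaQuot N).sub (h1.mul ((h2 1).add (h3.mul (h2 3))))

/-- Weierstrass M-test near `s₀`, with majorant (m+1)^(-2) because Re s - 5 ≤ -2. The bound holds
only from `N₀` on, so finitely many entire terms are split off. -/
theorem differentiableAt_tsum_quotRem {s₀ : ℂ} (hs₀ : s₀.re < 3) {n : ℕ} (hn : n ≠ 0) :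
    DifferentiableAt ℂ (fun s => ∑' m : ℕ, quotRem (n * (m + 1)) s) s₀ := by
  obtain ⟨C, hC, N₀, hN₀, hb⟩ := exists_norm_quotRem_le (‖s₀‖ + 1)
  set U : Set ℂ := Metric.ball s₀ 1 ∩ {s | s.re < 3} with hU
  have hUo : IsOpen U := Metric.isOpen_ball.inter (isOpen_lt Complex.continuous_re continuous_const)
  have hmem : s₀ ∈ U := ⟨Metric.mem_ball_self one_pos, hs₀⟩
  have hn1 : 1 ≤ n := Nat.pos_of_ne_zero hn
  have htail : DifferentiableOn ℂ (fun s => ∑' m : ℕ, quotRem (n * (m + N₀ + 1)) s) U := by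
    refine Complex.differentiableOn_tsum_of_summable_norm
      (u := fun m : ℕ => C * ((m + 1 : ℕ) : ℝ) ^ (-2 : ℝ)) ?_
      (fun m => (differentiable_quotRem _ (by positivity)).differentiableOn) hUo ?_
    · exact ((summable_nat_add_iff 1).2 (Real.summable_nat_rpow.2 (by norm_num))).mul_left C
    · intro m s hs
      have hs1 : ‖s‖ ≤ ‖s₀‖ + 1 := by
        have h1 := norm_add_le s₀ (s - s₀)
        have h2 := mem_ball_iff_norm.1 hs.1
        rw [add_sub_cancel] at h1
        linarith
      have hle : m + 1 ≤ n * (m + N₀ + 1) :=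
        (by omega : m + 1 ≤ m + N₀ + 1).trans (Nat.le_mul_of_pos_left _ hn1)
      have hle2 : N₀ ≤ n * (m + N₀ + 1) :=
        (by omega : N₀ ≤ m + N₀ + 1).trans (Nat.le_mul_of_pos_left _ hn1)
      refine (hb s hs1 _ hle2).trans ?_
      have hs3 : s.re < 3 := hs.2
      have hx1 : (1 : ℝ) ≤ ((n * (m + N₀ + 1) : ℕ) : ℝ) := by exact_mod_cast (by omega)
      gcongr
      refine (Real.rpow_le_rpow_of_exponent_le hx1 (by linarith : s.re - 5 ≤ -2)).trans ?_
      exact Real.rpow_le_rpow_of_nonpos (by positivity) (by exact_mod_cast hle) (by norm_num)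
  have hhead : DifferentiableOn ℂ (fun s => ∑ m ∈ Finset.range N₀, quotRem (n * (m + 1)) s) U :=
    DifferentiableOn.fun_sum fun m _ =>
      (differentiable_quotRem _ (by positivity)).differentiableOn
  have h : DifferentiableOn ℂ (fun s => ∑' m : ℕ, quotRem (n * (m + 1)) s) U := by
    refine (hhead.fun_add htail).congr fun s hs => ?_
    have hs3 : s.re < 3 := hs.2
    exact ((summable_quotRem_mul (s := s) (by linarith) hn).sum_add_tsum_nat_add N₀).symm
  exact h.differentiableAt (hUo.mem_nhds hmem)

/-- The punctured half-plane is a union of four convex pieces, attached successively through the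
common points i, -i and 2 + i. -/
theorem isPreconnected_re_lt_diff_singleton :
    IsPreconnected ({s : ℂ | s.re < 3} ∩ {1}ᶜ) := by
  have hA : IsPreconnected {s : ℂ | s.re < 1} := (convex_halfSpace_re_lt 1).isPreconnected
  have hB : IsPreconnected ({s : ℂ | s.re < 3} ∩ {s : ℂ | 0 < s.im}) :=
    ((convex_halfSpace_re_lt 3).inter (convex_halfSpace_im_gt 0)).isPreconnected
  have hC : IsPreconnected ({s : ℂ | s.re < 3} ∩ {s : ℂ | s.im < 0}) :=
    ((convex_halfSpace_re_lt 3).inter (convex_halfSpace_im_lt 0)).isPreconnected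
  have hE : IsPreconnected ({s : ℂ | s.re < 3} ∩ {s : ℂ | 1 < s.re}) :=
    ((convex_halfSpace_re_lt 3).inter (convex_halfSpace_re_gt 1)).isPreconnected
  have h1 := hA.union (x := Complex.I) (by simp) (by simp) hB
  have h2 := h1.union (x := -Complex.I) (by simp) (by simp) hC
  have h3 := h2.union (x := 2 + Complex.I) (Or.inl (Or.inr (by norm_num))) (by norm_num) hE
  convert h3 using 1
  ext s
  simp only [Set.mem_inter_iff, Set.mem_union, Set.mem_ofPred_eq, Set.mem_compl_iff,
    Set.mem_singleton_iff, Complex.ext_iff, Complex.one_re, Complex.one_im]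
  constructor
  · rintro ⟨h, h'⟩
    rcases lt_trichotomy s.re 1 with hr | hr | hr
    · tauto
    · rcases lt_trichotomy s.im 0 with hi | hi | hi <;> tauto
    · tauto
  · rintro (((h | ⟨h, h'⟩) | ⟨h, h'⟩) | ⟨h, h'⟩)
    · exact ⟨by linarith, fun hh => by linarith [hh.1]⟩
    · exact ⟨h, fun hh => by linarith [hh.2]⟩
    · exact ⟨h, fun hh => by linarith [hh.2]⟩
    · exact ⟨h, fun hh => by linarith [hh.1]⟩

theorem sin_pi_mul_div_pos {k n : ℕ} (hk : k ∈ Finset.Ico 1 n) : 0 < Real.sin (π * k / n) := by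
  have h := Finset.mem_Ico.1 hk
  have hn0 : (0 : ℝ) < n := by exact_mod_cast (by omega : 0 < n)
  rw [mul_div_assoc]
  refine sin_pi_mul_pos ⟨div_pos (by exact_mod_cast h.1) hn0, (div_lt_one hn0).2 ?_⟩
  exact_mod_cast h.2

/-- Identity theorem, starting from a neighbourhood of -1. In this half-plane only s = 1 must be
removed: the next pole of `gammaFactor` and the pole of ζ(s-2) both lie at s = 3. -/
theorem sum_sin_cpow_eq {s : ℂ} (hs : s.re < 3) (hs1 : s ≠ 1) {n : ℕ} (hn : n ≠ 0) :
    ∑ k ∈ Finset.Ico 1 n, 1 / ((Real.sin (π * k / n) : ℝ) : ℂ) ^ s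
      = cosecantMainTerm n s + 2 * n * gammaFactor s * ∑' m : ℕ, quotRem (n * (m + 1)) s := by
  have hn' : (n : ℂ) ≠ 0 := by exact_mod_cast hn
  have hpi : (π : ℂ) ≠ 0 := by exact_mod_cast Real.pi_ne_zero
  set D : Set ℂ := {s : ℂ | s.re < 3} ∩ {1}ᶜ with hD
  have hDo : IsOpen D :=
    (isOpen_lt Complex.continuous_re continuous_const).inter isOpen_compl_singleton
  have hL : AnalyticOnNhd ℂ
      (fun s : ℂ => ∑ k ∈ Finset.Ico 1 n, 1 / ((Real.sin (π * k / n) : ℝ) : ℂ) ^ s) D := by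
    refine DifferentiableOn.analyticOnNhd (DifferentiableOn.fun_sum fun k hk => ?_) hDo
    have hne : ((Real.sin (π * k / n) : ℝ) : ℂ) ≠ 0 := by
      exact_mod_cast (sin_pi_mul_div_pos hk).ne'
    have : Differentiable ℂ fun s : ℂ => ((Real.sin (π * k / n) : ℝ) : ℂ) ^ s := fun s =>
      DifferentiableAt.const_cpow differentiableAt_id (Or.inl hne)
    exact ((differentiable_const _).div this fun s h =>
      hne ((Complex.cpow_eq_zero_iff _ _).1 h).1).differentiableOn
  have hR : AnalyticOnNhd ℂ (fun s : ℂ => cosecantMainTerm n s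
      + 2 * n * gammaFactor s * ∑' m : ℕ, quotRem (n * (m + 1)) s) D := by
    refine DifferentiableOn.analyticOnNhd (fun s hs => DifferentiableAt.differentiableWithinAt ?_) hDo
    have hs3 : s.re < 3 := hs.1
    have hs1 : s ≠ 1 := hs.2
    have hs2 : s - 2 ≠ 1 := fun h => by
      have := congrArg Complex.re h
      simp at this; linarith
    have dG := differentiableAt_gammaFactor hs3 hs1
    have dE := differentiableAt_tsum_quotRem hs3 hn
    have d1 : DifferentiableAt ℂ (fun s : ℂ => (Complex.Gamma (1 - s / 2))⁻¹) s :=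
      (Complex.differentiable_one_div_Gamma.comp (by fun_prop :
        Differentiable ℂ fun s : ℂ => 1 - s / 2)).differentiableAt
    have d2 := differentiableAt_riemannZeta hs1
    have d3 : DifferentiableAt ℂ (fun s => riemannZeta (s - 2)) s :=
      DifferentiableAt.comp s (differentiableAt_riemannZeta hs2) (by fun_prop)
    have d4 : DifferentiableAt ℂ (fun s : ℂ => (π : ℂ) ^ (-s)) s :=
      DifferentiableAt.const_cpow (by fun_prop) (Or.inl hpi)
    have d5 : DifferentiableAt ℂ (fun s : ℂ => (π : ℂ) ^ (2 - s)) s :=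
      DifferentiableAt.const_cpow (by fun_prop) (Or.inl hpi)
    have d6 : DifferentiableAt ℂ (fun s : ℂ => (n : ℂ) ^ s) s :=
      DifferentiableAt.const_cpow (by fun_prop) (Or.inl hn')
    have d7 : DifferentiableAt ℂ (fun s : ℂ => (n : ℂ) ^ (s - 2)) s :=
      DifferentiableAt.const_cpow (by fun_prop) (Or.inl hn')
    unfold cosecantMainTerm
    fun_prop
  refine hL.eqOn_of_preconnected_of_eventuallyEq hR isPreconnected_re_lt_diff_singleton
    (z₀ := -1) ⟨by norm_num, by norm_num⟩ ?_ ⟨hs, hs1⟩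
  have : {s : ℂ | s.re < 0} ∈ nhds (-1 : ℂ) :=
    (isOpen_lt Complex.continuous_re continuous_const).mem_nhds (by simp)
  filter_upwards [this] with s hs using sum_sin_cpow_eq_of_re_neg hs hn

/-! ### Asymptotics in n -/

theorem norm_natCast_cpow {n : ℕ} (hn : n ≠ 0) (w : ℂ) : ‖(n : ℂ) ^ w‖ = (n : ℝ) ^ w.re :=
  Complex.norm_natCast_cpow_of_pos (Nat.pos_of_ne_zero hn) w

open Filter in
theorem sum_sin_cpow_sub_isBigO {s : ℂ} (hs : s.re < 3) (hs1 : s ≠ 1) :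
    (fun n : ℕ => (∑ k ∈ Finset.Ico 1 n, 1 / ((Real.sin (π * k / n) : ℝ) : ℂ) ^ s)
      - cosecantMainTerm n s) =O[atTop] fun n : ℕ => (n : ℂ) ^ (s - 4) := by
  obtain ⟨C, hC, N₀, hN₀, hb⟩ := exists_norm_quotRem_le ‖s‖
  have hsum : Summable fun m : ℕ => ((m + 1 : ℕ) : ℝ) ^ (s.re - 5) :=
    (summable_nat_add_iff 1).2 (Real.summable_nat_rpow.2 (by linarith))
  refine Asymptotics.IsBigO.of_bound
    (2 * ‖gammaFactor s‖ * (C * ∑' m : ℕ, ((m + 1 : ℕ) : ℝ) ^ (s.re - 5))) ?_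
  filter_upwards [eventually_ge_atTop N₀] with n hn
  have hn0 : n ≠ 0 := by omega
  have hnr : (0 : ℝ) < n := by exact_mod_cast Nat.pos_of_ne_zero hn0
  -- The bound at n(m+1) factors as a power of n times a convergent series in m; the prefactor n
  -- then raises the exponent to Re s - 4.
  have hE : ‖∑' m : ℕ, quotRem (n * (m + 1)) s‖
      ≤ C * (n : ℝ) ^ (s.re - 5) * ∑' m : ℕ, ((m + 1 : ℕ) : ℝ) ^ (s.re - 5) := by
    refine tsum_of_norm_bounded (hsum.hasSum.mul_left _) fun m => ?_
    refine (hb s le_rfl _ (hn.trans (Nat.le_mul_of_pos_right n (Nat.succ_pos m)))).trans ?_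
    rw [mul_assoc, ← Real.mul_rpow hnr.le (by positivity)]
    push_cast
    rfl
  rw [sum_sin_cpow_eq hs hs1 hn0, add_sub_cancel_left, norm_mul, norm_mul, norm_mul,
    Complex.norm_ofNat, Complex.norm_natCast, norm_natCast_cpow hn0]
  have e : (n : ℝ) ^ (s - 4).re = n * (n : ℝ) ^ (s.re - 5) := by
    rw [show (s - 4).re = 1 + (s.re - 5) by simp; ring, Real.rpow_add hnr, Real.rpow_one]
  rw [e]
  calc 2 * n * ‖gammaFactor s‖ * ‖∑' m : ℕ, quotRem (n * (m + 1)) s‖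
      ≤ 2 * n * ‖gammaFactor s‖ *
        (C * (n : ℝ) ^ (s.re - 5) * ∑' m : ℕ, ((m + 1 : ℕ) : ℝ) ^ (s.re - 5)) := by gcongr
    _ = _ := by ring

open Filter in
theorem natCast_cpow_isLittleO {a b : ℂ} (h : a.re < b.re) :
    (fun n : ℕ => (n : ℂ) ^ a) =o[atTop] fun n : ℕ => (n : ℂ) ^ b := by
  rw [← Asymptotics.isLittleO_norm_norm, Asymptotics.isLittleO_iff_tendsto']
  · have h1 := (tendsto_rpow_neg_atTop (sub_pos.2 h)).comp tendsto_natCast_atTop_atTop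
    refine h1.congr' ?_
    filter_upwards [eventually_ne_atTop 0] with n hn
    have hnr : (0 : ℝ) < n := by exact_mod_cast Nat.pos_of_ne_zero hn
    rw [norm_natCast_cpow hn, norm_natCast_cpow hn, ← Real.rpow_sub hnr, Function.comp, neg_sub]
  · filter_upwards [eventually_ne_atTop 0] with n hn h0
    have hnr : (0 : ℝ) < n := by exact_mod_cast Nat.pos_of_ne_zero hn
    rw [norm_natCast_cpow hn] at h0
    exact absurd h0 (Real.rpow_pos_of_pos hnr _).ne'

theorem mainTheorem2 :
    (∀ s : ℂ, s ≠ 1 → s.re < 3 →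
      (fun n : ℕ =>
          (∑ k ∈ Finset.Ico 1 n, 1 / ((Real.sin (π * k / n) : ℝ) : ℂ) ^ s)
            - ((1 / (Real.sqrt π : ℂ)) * (Complex.Gamma (1 / 2 - s / 2) / Complex.Gamma (1 - s / 2)) * n
              + 2 * (π : ℂ) ^ (-s) * riemannZeta s * (n : ℂ) ^ s))
        =o[Filter.atTop] (fun n : ℕ => (n : ℂ) ^ s)) ∧
    (∀ s : ℂ, 0 < s.re → s.re < 1 →
      (fun n : ℕ =>
          (∑ k ∈ Finset.Ico 1 n, 1 / ((Real.sin (π * k / n) : ℝ) : ℂ) ^ s)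
            - ((1 / (Real.sqrt π : ℂ)) * (Complex.Gamma (1 / 2 - s / 2) / Complex.Gamma (1 - s / 2)) * n
              + 2 * (π : ℂ) ^ (-s) * riemannZeta s * (n : ℂ) ^ s
              + (s / 3) * (π : ℂ) ^ (2 - s) * riemannZeta (s - 2) * (n : ℂ) ^ (s - 2)))
        =o[Filter.atTop] (fun n : ℕ => (n : ℂ) ^ (s - 2))) := by
  refine ⟨fun s hs1 hs => ?_, fun s _ hs => ?_⟩
  · have h1 := (sum_sin_cpow_sub_isBigO hs hs1).trans_isLittleO
      (natCast_cpow_isLittleO (a := s - 4) (b := s) (by simp))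
    -- The third main term is absorbed into o(n^s).
    have h2 := (natCast_cpow_isLittleO (a := s - 2) (b := s) (by simp)).const_mul_left
      (s / 3 * (π : ℂ) ^ (2 - s) * riemannZeta (s - 2))
    refine (h1.add h2).congr_left fun n => ?_
    rw [cosecantMainTerm, gammaFactor]
    ring
  · have hs1 : s ≠ 1 := fun h => by rw [h] at hs; simp at hs
    refine ((sum_sin_cpow_sub_isBigO (by linarith) hs1).trans_isLittleO
      (natCast_cpow_isLittleO (a := s - 4) (b := s - 2) (by simp; norm_num))).congr_left fun n => ?_
    rw [cosecantMainTerm, gammaFactor]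
    ring
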